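/- There is a function $\omega:\mathbb{R}\to\mathbb{R}$ with $\omega(\delta)\to 0$ as $\delta\to 0^+$ such that the following holds. Let $Z$ be a compact metrizable Abelian group and let $K_1,K_2\le Z$ be closed subgroups such that $K_1\cap K_2=\{1\}$ and $K_1K_2$ has finite index in $Z$. Let $m_Z,m_{K_1},m_{K_2}$ be the Haar probability measures, and $m_{K_1\times K_2}=m_{K_1}\otimes m_{K_2}$, $m_{Z\times K_1\times K_2}=m_Z\otimes m_{K_1}\otimes m_{K_2}$. Write $\mathrm{S}^1$ for the unit circle in $\mathbb{C}$, and $F\approx_\varepsilon G$ in $L^2(\mu)$ for $\|F-G\|_{L^2(\mu)}\le\varepsilon$. Let $0<\delta<1/100$, and let $f_1,f_2,f_3:Z\to\mathrm{S}^1$ and $h:K_1\times K_2\to\mathrm{S}^1$ be Borel functions such that \[f_1(zu)\,f_2(zuv)\,f_3(zv)\,h(u,v)\approx_\delta 1\quad\text{in } L^2(m_{Z\times K_1\times K_2}),\qquad z\in Z,\ u\in K_1,\ v\in K_2.\] Then there are Borel functions $g_1:Z/K_2\to\mathrm{S}^1$ and $g_2:Z/K_1\to\mathrm{S}^1$, continuous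 characters $\gamma_1,\gamma_2:Z\to\mathrm{S}^1$ with $\gamma_1|_{K_2}\equiv 1$ and $\gamma_2|_{K_1}\equiv 1$, and constants $\alpha_1,\alpha_2,\alpha_3,\beta\in\mathrm{S}^1$ with $\alpha_1\alpha_2\alpha_3\beta=1$ such that \[f_1(z)\approx_{\omega(\delta)}\alpha_1\,g_1(zK_2)\,\gamma_2(z),\] \[f_2(z)\approx_{\omega(\delta)}\alpha_2\,\overline{g_1(zK_2)\,\gamma_1(z)\,g_2(zK_1)\,\gamma_2(z)},\] \[f_3(z)\approx_{\omega(\delta)}\alpha_3\,g_2(zK_1)\,\gamma_1(z)\] in $L^2(m_Z)$, and \[h(u,v)\approx_{\omega(\delta)}\beta\,\gamma_1(u)\,\gamma_2(v)\quad\text{in } L^2(m_{K_1\times K_2}).\] Consequently also \[f_1(z)f_2(z)f_3(z)\approx_{\omega(\delta)}\alpha_1g_1(zK_2)\gamma_2(z)\cdot\alpha_2\overline{g_1(zK_2)\gamma_1(z)g_2(zK_1)\gamma_2(z)}\cdot\alpha_3g_2(zK_1)\gamma_1(z)\equiv\overline{\beta}\quad\text{in } L^2(m_Z).\] -/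

import Mathlib

open MeasureTheory Filter Topology

universe u

noncomputable instance instMeasurableSpaceCircle : MeasurableSpace Circle := borel Circle

instance instBorelSpaceCircle : BorelSpace Circle := ⟨rfl⟩

/-- `F ≈_ε G` in `L²(μ)` for circle-valued functions: `‖F - G‖_{L²(μ)} ≤ ε`, the values being
regarded as complex numbers. -/
def L2Close {X : Type*} [MeasurableSpace X] (μ : Measure X) (ε : ℝ) (F G : X → Circle) : Prop :=
  eLpNorm (fun x => (F x : ℂ) - (G x : ℂ)) 2 μ ≤ ENNReal.ofReal ε

open scoped ENNReal

/-! Substituting `z ↦ z(uv)⁻¹` turns the hypothesis into `f₁(zv⁻¹) f₂(z) f₃(zu⁻¹) h(u,v) ≈ 1`. At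
two values of `u`, with `z` and `v` shared, the factors `f₁` and `f₂` cancel. Fixing one of the
values and `v` leaves `f₃(zs) ≈ c(s) f₃(z)` for most `s ∈ K₁`, that is, `f₃` is nearly an
eigenfunction of translation by `K₁`.

This improves to a statement about every `s`, since each `s` is a product of two good elements. The
multiplier can be taken continuous, as the normalized autocorrelation of `f₃`, and is then
approximately multiplicative. Its small defect is a real 2-cocycle, trivialized by averaging over
the compact group, so the multiplier is near a genuine character of `K₁` (`exists_character_near`).
Divisibility of the circle and openness of `K₁K₂` extend that character to `γ₁` on `Z`, trivial on
`K₂` (`exists_character_extension`). Now `f₃ γ₁⁻¹` is nearly `K₁`-invariant, hence near a function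
on `Z/K₁` (`exists_quotient_close`), and feeding this back gives `h ≈ γ₁(u) b(v)`.

The equation is symmetric under exchanging `(f₁, K₂)` with `(f₃, K₁)`, so also `h ≈ a(u) γ₂(v)`.
Together these give `h ≈ β γ₁(u) γ₂(v)`, and the equation is solved for `f₂`. All losses are linear
in `δ`. -/

theorem Circle.norm_coe_inv_sub (a b : Circle) :
    ‖((a⁻¹ : Circle) : ℂ) - ((b⁻¹ : Circle) : ℂ)‖ = ‖(a : ℂ) - b‖ := by
  rw [Circle.coe_inv_eq_conj, Circle.coe_inv_eq_conj, ← map_sub, RCLike.norm_conj]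

theorem Circle.norm_coe_mul_sub_mul_left (a b c : Circle) :
    ‖((a * b : Circle) : ℂ) - ((a * c : Circle) : ℂ)‖ = ‖(b : ℂ) - c‖ := by
  rw [Circle.coe_mul, Circle.coe_mul, ← mul_sub, norm_mul, Circle.norm_coe, one_mul]

theorem Circle.measurable_coe : Measurable fun z : Circle => (z : ℂ) :=
  Continuous.measurable (by fun_prop)

/-! ### Calculus of L² closeness for circle-valued functions -/

namespace L2Close

variable {X Y : Type*} [MeasurableSpace X] [MeasurableSpace Y] {μ : Measure X} {ν : Measure Y}
  {ε ε' : ℝ} {F G H F' G' : X → Circle}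

theorem aestronglyMeasurable_sub (hF : Measurable F) (hG : Measurable G) :
    AEStronglyMeasurable (fun x => (F x : ℂ) - (G x : ℂ)) μ :=
  ((Circle.measurable_coe.comp hF).sub
    (Circle.measurable_coe.comp hG)).aestronglyMeasurable

theorem of_norm_eq (h : L2Close μ ε F G)
    (hn : ∀ x, ‖(F' x : ℂ) - G' x‖ = ‖(F x : ℂ) - G x‖) : L2Close μ ε F' G' := by
  unfold L2Close at *
  rwa [eLpNorm_congr_norm_ae (Eventually.of_forall hn)]

theorem congr (h : L2Close μ ε F G) (hF : ∀ x, F' x = F x) (hG : ∀ x, G' x = G x) :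
    L2Close μ ε F' G' :=
  h.of_norm_eq fun x => by rw [hF, hG]

theorem mono (h : L2Close μ ε F G) (hε : ε ≤ ε') : L2Close μ ε' F G :=
  le_trans h (ENNReal.ofReal_le_ofReal hε)

theorem symm (h : L2Close μ ε F G) : L2Close μ ε G F :=
  h.of_norm_eq fun _ => norm_sub_rev _ _

theorem trans (hF : Measurable F) (hG : Measurable G) (hH : Measurable H) (h0 : 0 ≤ ε)
    (h0' : 0 ≤ ε') (h : L2Close μ ε F G) (h' : L2Close μ ε' G H) : L2Close μ (ε + ε') F H := by
  unfold L2Close at *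
  have : (fun x => (F x : ℂ) - (H x : ℂ))
      = (fun x => (F x : ℂ) - (G x : ℂ)) + fun x => (G x : ℂ) - (H x : ℂ) := by
    ext x; simp
  rw [this, ENNReal.ofReal_add h0 h0']
  exact (eLpNorm_add_le (aestronglyMeasurable_sub hF hG) (aestronglyMeasurable_sub hG hH)
    (by norm_num)).trans (add_le_add h h')

theorem inv (h : L2Close μ ε F G) :
    L2Close μ ε (fun x => (F x)⁻¹) (fun x => (G x)⁻¹) :=
  h.of_norm_eq fun _ => Circle.norm_coe_inv_sub _ _

theorem mul_left (h : L2Close μ ε F G) (H : X → Circle) :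
    L2Close μ ε (fun x => H x * F x) (fun x => H x * G x) :=
  h.of_norm_eq fun _ => Circle.norm_coe_mul_sub_mul_left _ _ _

theorem mul (hF : Measurable F) (hG : Measurable G) (hF' : Measurable F') (hG' : Measurable G')
    (h0 : 0 ≤ ε) (h0' : 0 ≤ ε') (h : L2Close μ ε F G) (h' : L2Close μ ε' F' G') :
    L2Close μ (ε + ε') (fun x => F x * F' x) (fun x => G x * G' x) := by
  have h1 := h.mul_left F'
  have h2 := h'.mul_left G
  simp only [mul_comm (F' _)] at h1
  exact trans (hF.mul hF') (hG.mul hF') (hG.mul hG') h0 h0' h1 h2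

theorem comp (hF : Measurable F) (hG : Measurable G) {T : Y → X} (hT : MeasurePreserving T ν μ)
    (h : L2Close μ ε F G) : L2Close ν ε (fun y => F (T y)) (fun y => G (T y)) := by
  unfold L2Close at *
  exact (eLpNorm_comp_measurePreserving (aestronglyMeasurable_sub hF hG) hT).trans_le h

theorem iff_lintegral (h0 : 0 ≤ ε) :
    L2Close μ ε F G ↔ ∫⁻ x, ‖(F x : ℂ) - G x‖ₑ ^ 2 ∂μ ≤ ENNReal.ofReal (ε ^ 2) := by
  unfold L2Close
  rw [eLpNorm_eq_lintegral_rpow_enorm_toReal (by norm_num) (by norm_num)]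
  simp only [ENNReal.toReal_ofNat, ENNReal.rpow_ofNat, one_div]
  rw [ENNReal.ofReal_pow h0, ENNReal.rpow_inv_le_iff (by norm_num), ENNReal.rpow_ofNat]

theorem measurable_enorm_sub_sq (hF : Measurable F) (hG : Measurable G) :
    Measurable fun x => ‖(F x : ℂ) - G x‖ₑ ^ 2 :=
  (((Circle.measurable_coe.comp hF).sub
    (Circle.measurable_coe.comp hG)).enorm).pow_const 2

theorem exists_fibre [SFinite μ] [IsProbabilityMeasure ν] {F G : X × Y → Circle}
    (hF : Measurable F) (hG : Measurable G)
    (h0 : 0 ≤ ε) (h : L2Close (μ.prod ν) ε F G) :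
    ∃ y, L2Close μ ε (fun x => F (x, y)) (fun x => G (x, y)) := by
  rw [iff_lintegral h0, lintegral_prod_symm' _ (measurable_enorm_sub_sq hF hG)] at h
  obtain ⟨y, hy⟩ := exists_le_lintegral
    ((measurable_enorm_sub_sq hF hG).lintegral_prod_left' (μ := μ)).aemeasurable (μ := ν)
  exact ⟨y, (iff_lintegral h0).2 (hy.trans h)⟩

theorem exists_fibre_left [IsProbabilityMeasure μ] [IsProbabilityMeasure ν]
    {F G : X × Y → Circle} (hF : Measurable F) (hG : Measurable G)
    (h0 : 0 ≤ ε) (h : L2Close (μ.prod ν) ε F G) :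
    ∃ x, L2Close ν ε (fun y => F (x, y)) (fun y => G (x, y)) :=
  exists_fibre (F := F ∘ Prod.swap) (G := G ∘ Prod.swap) (hF.comp measurable_swap)
    (hG.comp measurable_swap) h0 (h.comp hF hG Measure.measurePreserving_swap)

theorem prod_of_forall [SFinite μ] [IsProbabilityMeasure ν] {F G : X × Y → Circle}
    (hF : Measurable F) (hG : Measurable G)
    (h0 : 0 ≤ ε) (h : ∀ y, L2Close μ ε (fun x => F (x, y)) (fun x => G (x, y))) :
    L2Close (μ.prod ν) ε F G := by
  rw [iff_lintegral h0, lintegral_prod_symm' _ (measurable_enorm_sub_sq hF hG)]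
  calc _ ≤ ∫⁻ _ : Y, ENNReal.ofReal (ε ^ 2) ∂ν :=
        lintegral_mono fun y => (iff_lintegral h0).1 (h y)
    _ = _ := by simp

theorem const_iff [IsProbabilityMeasure μ] {a b : Circle} (h0 : 0 ≤ ε) :
    L2Close μ ε (fun _ => a) (fun _ => b) ↔ ‖(a : ℂ) - b‖ ≤ ε := by
  unfold L2Close
  rw [eLpNorm_const _ (by norm_num) (IsProbabilityMeasure.ne_zero μ)]
  simp only [measure_univ, ENNReal.one_rpow, mul_one]
  rw [← ofReal_norm, ENNReal.ofReal_le_ofReal_iff h0]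

/-- By Markov's inequality, most fibres are close with twice the bound. -/
theorem measure_not_fibre_le [SFinite μ] [IsProbabilityMeasure ν] {F G : X × Y → Circle}
    (hF : Measurable F) (hG : Measurable G) (h0 : 0 < ε) (h : L2Close (μ.prod ν) ε F G) :
    ν {y | ¬ L2Close μ (2 * ε) (fun x => F (x, y)) (fun x => G (x, y))} ≤ 1 / 4 := by
  rw [iff_lintegral h0.le, lintegral_prod_symm' _ (measurable_enorm_sub_sq hF hG)] at h
  have hm := (measurable_enorm_sub_sq hF hG).lintegral_prod_left' (μ := μ)
  -- The threshold `(2ε)²` is four times the bound `ε²` on the mean, whence `1/4`.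
  have h1 := mul_meas_ge_le_lintegral (μ := ν) hm (ENNReal.ofReal ((2 * ε) ^ 2))
  have h2 : ν {y | ¬ L2Close μ (2 * ε) (fun x => F (x, y)) (fun x => G (x, y))}
      ≤ ν {y | ENNReal.ofReal ((2 * ε) ^ 2) ≤ ∫⁻ x, ‖(F (x, y) : ℂ) - G (x, y)‖ₑ ^ 2 ∂μ} := by
    refine measure_mono fun y hy => ?_
    rw [Set.mem_ofPred_eq, iff_lintegral (by positivity), not_le] at hy
    exact hy.le
  refine h2.trans ?_
  have h3 := h1.trans h
  have h4 : ENNReal.ofReal ((2 * ε) ^ 2) = ENNReal.ofReal (ε ^ 2) * 4 := by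
    rw [show (4 : ℝ≥0∞) = ENNReal.ofReal 4 by simp, ← ENNReal.ofReal_mul (by positivity)]
    congr 1; ring
  rw [h4, mul_assoc] at h3
  have h5 : ENNReal.ofReal (ε ^ 2) ≠ 0 := by simp; positivity
  rw [ENNReal.le_div_iff_mul_le (by simp) (by simp), mul_comm]
  refine (ENNReal.mul_le_mul_iff_right h5 ENNReal.ofReal_ne_top).1 ?_
  simpa [h4] using h3

end L2Close

/-! ### Approximate homomorphisms to the circle -/

theorem Circle.abs_arg_le (z : Circle) :
    |Complex.arg z| ≤ Real.pi / 2 * ‖(z : ℂ) - 1‖ := by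
  rw [← Complex.angle_one_right z.coe_ne_zero]
  exact Complex.angle_le_mul_norm_sub z.norm_coe norm_one

theorem Circle.arg_mul_eq_add {x y : Circle} (hx : |Complex.arg x| < Real.pi / 2)
    (hy : |Complex.arg y| < Real.pi / 2) :
    Complex.arg ((x * y : Circle) : ℂ) = Complex.arg x + Complex.arg y := by
  rw [Circle.coe_mul, Complex.arg_mul_eq_add_arg_iff (by simp) (by simp)]
  rw [abs_lt] at hx hy
  constructor <;> linarith

theorem Circle.norm_exp_sub_one_le (t : ℝ) : ‖(Circle.exp t : ℂ) - 1‖ ≤ |t| := by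
  rw [Circle.coe_exp, mul_comm]
  simpa using Real.norm_exp_I_mul_ofReal_sub_one_le (x := t)

/-- A continuous approximate homomorphism from a compact abelian group to the circle is uniformly
close to a continuous character. -/
theorem exists_character_near {K : Type*} [CommGroup K] [TopologicalSpace K]
    [IsTopologicalGroup K] [CompactSpace K] [FirstCountableTopology K] [MeasurableSpace K]
    [BorelSpace K] (μ : Measure K) [IsProbabilityMeasure μ] [μ.IsMulLeftInvariant]
    (c : K → Circle) (hc : Continuous c) {η : ℝ} (hη : η < 1)
    (h : ∀ s t, ‖(c (s * t) : ℂ) - ((c s * c t : Circle) : ℂ)‖ ≤ η) :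
    ∃ γ : K →ₜ* Circle, ∀ s, ‖(c s : ℂ) - γ s‖ ≤ 2 * η := by
  -- `κ` is the multiplicative defect of `c`. As `η < 1`, its argument `θ` stays below `π/2`, so
  -- arguments add without wrapping and `θ` is a continuous real 2-cocycle.
  set κ : K → K → Circle := fun s t => c s * c t * (c (s * t))⁻¹ with hκ
  set θ : K → K → ℝ := fun s t => Complex.arg (κ s t) with hθ
  have hκ1 : ∀ s t, ‖(κ s t : ℂ) - 1‖ ≤ η := fun s t => by
    have h1 := Circle.norm_coe_mul_sub_mul_left (c (s * t)) (κ s t) 1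
    rw [Circle.coe_one] at h1
    rw [← h1, norm_sub_rev]
    have e : c (s * t) * κ s t = c s * c t := by simp [hκ]
    rw [e, mul_one]
    exact h s t
  have hθle : ∀ s t, |θ s t| ≤ Real.pi / 2 * η := fun s t =>
    (Circle.abs_arg_le _).trans (mul_le_mul_of_nonneg_left (hκ1 s t) (by positivity))
  have hθlt : ∀ s t, |θ s t| < Real.pi / 2 := fun s t =>
    (hθle s t).trans_lt (by nlinarith [Real.pi_pos])
  have hcoc : ∀ s t r, θ s t + θ (s * t) r = θ t r + θ s (t * r) := fun s t r => by
    simp only [hθ]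
    rw [← Circle.arg_mul_eq_add (hθlt s t) (hθlt _ r),
      ← Circle.arg_mul_eq_add (hθlt t r) (hθlt s _)]
    congr 2
    simp only [hκ, mul_assoc s t r]
    exact Circle.ext (by push_cast; field_simp)
  have hcont : Continuous (Function.uncurry θ) := by
    rw [continuous_iff_continuousAt]
    rintro ⟨s, t⟩
    have h1 : Continuous fun p : K × K => ((κ p.1 p.2 : Circle) : ℂ) := by
      simp only [hκ]; fun_prop
    refine ContinuousAt.comp (f := fun p : K × K => ((κ p.1 p.2 : Circle) : ℂ))
      (Complex.continuousAt_arg ?_) h1.continuousAt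
    refine Complex.mem_slitPlane_iff_arg.2 ⟨fun h2 => ?_, by simp⟩
    have := hθlt s t
    simp only [hθ, h2, abs_of_pos Real.pi_pos] at this
    linarith [Real.pi_pos]
  -- Integrating the cocycle identity over `r`, with translation invariance, exhibits `θ` as the
  -- coboundary of `b`. Dividing `c` by `exp b` then removes the defect exactly.
  set b : K → ℝ := fun s => ∫ r, θ s r ∂μ with hb
  have hint : ∀ s, Integrable (θ s) μ := fun s =>
    Continuous.integrable_of_hasCompactSupport (by fun_prop)
      (HasCompactSupport.of_compactSpace _)
  have hbcont : Continuous b := continuous_parametric_integral_of_continuous hcont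
      isCompact_univ |> fun h => by simpa using h
  have hbeq : ∀ s t, θ s t + b (s * t) = b t + b s := fun s t => by
    have h1 : ∫ r, (θ s t + θ (s * t) r) ∂μ = ∫ r, (θ t r + θ s (t * r)) ∂μ := by
      simp_rw [hcoc]
    rw [integral_add (integrable_const _) (hint _),
      integral_add (hint _) ((hint s).comp_mul_left t),
      integral_mul_left_eq_self (θ s) t] at h1
    simpa using h1
  have hble : ∀ s, |b s| ≤ Real.pi / 2 * η := fun s => by
    have := norm_integral_le_of_norm_le_const (μ := μ) (f := θ s)
      (Eventually.of_forall (hθle s))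
    simpa using this
  have hexp : ∀ s t, κ s t = Circle.exp (b s) * Circle.exp (b t) * (Circle.exp (b (s * t)))⁻¹ :=
    fun s t => by
      have h1 : θ s t = b s + b t - b (s * t) := by linarith [hbeq s t]
      rw [← Circle.exp_arg (κ s t), show Complex.arg (κ s t) = θ s t from rfl, h1,
        Circle.exp_sub, Circle.exp_add, div_eq_mul_inv]
  let γ₀ : K →* Circle := MonoidHom.mk' (fun s => c s * (Circle.exp (b s))⁻¹) fun s t => by
    have h1 := hexp s t
    simp only [hκ] at h1
    have h2 : c s * c t
        = Circle.exp (b s) * Circle.exp (b t) * (Circle.exp (b (s * t)))⁻¹ * c (s * t) := by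
      rw [← h1, inv_mul_cancel_right]
    rw [mul_mul_mul_comm, h2]
    exact Circle.ext (by push_cast; field_simp)
  refine ⟨⟨γ₀, ?_⟩, fun s => ?_⟩
  · change Continuous fun s => c s * (Circle.exp (b s))⁻¹
    fun_prop
  · change ‖(c s : ℂ) - ((c s * (Circle.exp (b s))⁻¹ : Circle) : ℂ)‖ ≤ _
    have h1 := Circle.norm_coe_mul_sub_mul_left (c s) 1 (Circle.exp (b s))⁻¹
    have h2 := Circle.norm_coe_inv_sub 1 (Circle.exp (b s))
    rw [mul_one] at h1
    rw [inv_one] at h2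
    rw [h1, h2, norm_sub_rev, Circle.coe_one]
    have h0 : 0 ≤ η := (norm_nonneg _).trans (h 1 1)
    refine (Circle.norm_exp_sub_one_le _).trans ((hble s).trans ?_)
    -- The constant `2` comes from `π/2 ≤ 2`.
    nlinarith [Real.pi_le_four]

/-! ### Radial projection and averages of circle-valued functions -/

namespace Circle

/-- The radial projection of the plane to the circle, with value `1` at the origin. -/
noncomputable def normalize (w : ℂ) : Circle := Circle.exp w.arg

theorem coe_normalize_mul_norm (w : ℂ) : (‖w‖ : ℂ) * (normalize w : ℂ) = w := by
  rw [normalize, Circle.coe_exp, Complex.norm_mul_exp_arg_mul_I]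

theorem measurable_normalize : Measurable normalize :=
  Circle.exp.continuous.measurable.comp Complex.measurable_arg

/-- The projection moves `w` by `|1 - ‖w‖|`, which is at most `‖w - u‖` because `‖u‖ = 1`. -/
theorem norm_normalize_sub_le (w : ℂ) (u : Circle) :
    ‖(normalize w : ℂ) - u‖ ≤ 2 * ‖w - u‖ := by
  have h1 : ‖(normalize w : ℂ) - w‖ = |1 - ‖w‖| := by
    have : (normalize w : ℂ) - w = ((1 - ‖w‖ : ℝ) : ℂ) * (normalize w : ℂ) := by
      push_cast
      rw [sub_mul, coe_normalize_mul_norm, one_mul]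
    rw [this, norm_mul, Circle.norm_coe, mul_one, Complex.norm_real, Real.norm_eq_abs]
  have h2 : |1 - ‖w‖| ≤ ‖w - u‖ := by
    have := abs_norm_sub_norm_le (u : ℂ) w
    rwa [Circle.norm_coe, norm_sub_rev] at this
  have h3 := norm_sub_le_norm_sub_add_norm_sub (normalize w : ℂ) w u
  linarith

theorem continuous_normalize_comp {X : Type*} [TopologicalSpace X] {φ : X → ℂ}
    (hφ : Continuous φ) (h0 : ∀ x, φ x ≠ 0) : Continuous fun x => normalize (φ x) := by
  refine Topology.IsInducing.subtypeVal.continuous_iff.2 ?_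
  have : (fun x => φ x / (‖φ x‖ : ℂ)) = fun x => (normalize (φ x) : ℂ) := by
    ext x
    rw [div_eq_iff (by simpa using h0 x), mul_comm, coe_normalize_mul_norm]
  change Continuous fun x => (normalize (φ x) : ℂ)
  rw [← this]
  exact hφ.div (by fun_prop) fun x => by simpa using h0 x

end Circle

section

variable {X : Type*} [MeasurableSpace X] {μ : Measure X}

theorem Circle.integrable_coe [IsFiniteMeasure μ] {F : X → Circle} (hF : Measurable F) :
    Integrable (fun x => (F x : ℂ)) μ :=
  Integrable.of_bound (Circle.measurable_coe.comp hF).aestronglyMeasurable 1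
    (Eventually.of_forall fun _ => (Circle.norm_coe _).le)

/-- On a probability space the L¹ norm is at most the L² norm. -/
theorem Circle.enorm_integral_sub_sq_le [IsProbabilityMeasure μ] {F : X → Circle}
    (hF : Measurable F) (a : Circle) :
    ‖∫ x, (F x : ℂ) ∂μ - a‖ₑ ^ 2 ≤ ∫⁻ x, ‖(F x : ℂ) - a‖ₑ ^ 2 ∂μ := by
  have h1 : ∫ x, (F x : ℂ) ∂μ - a = ∫ x, ((F x : ℂ) - a) ∂μ := by
    rw [integral_sub (Circle.integrable_coe hF) (integrable_const _)]
    simp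
  have hm := L2Close.aestronglyMeasurable_sub (μ := μ) hF (measurable_const (a := a))
  have h2 := eLpNorm_le_eLpNorm_of_exponent_le (p := 1) (q := 2) (by norm_num) hm
  rw [eLpNorm_one_eq_lintegral_enorm,
    eLpNorm_eq_lintegral_rpow_enorm_toReal (by norm_num) (by norm_num)] at h2
  simp only [ENNReal.toReal_ofNat, ENNReal.rpow_ofNat, one_div] at h2
  rw [h1]
  have h3 := (enorm_integral_le_lintegral_enorm (μ := μ) fun x => (F x : ℂ) - a).trans h2
  rwa [ENNReal.le_rpow_inv_iff (by norm_num), ENNReal.rpow_ofNat] at h3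

theorem L2Close.norm_integral_sub_le [IsProbabilityMeasure μ] {F : X → Circle}
    (hF : Measurable F) {a : Circle} {ε : ℝ} (h0 : 0 ≤ ε) (h : L2Close μ ε F fun _ => a) :
    ‖∫ x, (F x : ℂ) ∂μ - a‖ ≤ ε := by
  have h1 := (Circle.enorm_integral_sub_sq_le hF a).trans ((L2Close.iff_lintegral h0).1 h)
  rw [← ofReal_norm, ← ENNReal.ofReal_pow (norm_nonneg _),
    ENNReal.ofReal_le_ofReal_iff (by positivity)] at h1
  exact (pow_le_pow_iff_left₀ (norm_nonneg _) h0 two_ne_zero).1 h1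

end

/-! ### Multiplicative derivatives along a subgroup -/

section

variable {Z : Type*} [CommGroup Z] [TopologicalSpace Z] [IsTopologicalGroup Z]
  [MeasurableSpace Z] [BorelSpace Z]

/-- Approximate multiplicative derivatives of `f` compose. -/
theorem L2Close.derivative_mul {m : Measure Z} [m.IsHaarMeasure] {f : Z → Circle}
    (hf : Measurable f) {s t : Z} {a b : Circle} {ε ε' : ℝ} (h0 : 0 ≤ ε) (h0' : 0 ≤ ε')
    (hs : L2Close m ε (fun z => f (z * s) * (f z)⁻¹) fun _ => a)
    (ht : L2Close m ε' (fun z => f (z * t) * (f z)⁻¹) fun _ => b) :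
    L2Close m (ε + ε') (fun z => f (z * (s * t)) * (f z)⁻¹) fun _ => a * b := by
  have ht' := ht.comp (by fun_prop) (by fun_prop) (measurePreserving_mul_right m s)
  have := L2Close.mul (by fun_prop) (by fun_prop) (by fun_prop) (by fun_prop) h0 h0' hs ht'
  refine this.of_norm_eq fun z => ?_
  rw [← mul_assoc z s t]
  rw [mul_comm (f (z * s) * (f z)⁻¹), mul_assoc (f _), inv_mul_cancel_left]

variable [CompactSpace Z] [TopologicalSpace.MetrizableSpace Z]

/-- The integral is the inner product of `f` with its translate, and translation is strongly
continuous on L². This is the source of continuity for the characters, `f` itself being only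
measurable. -/
theorem continuous_autocorrelation (m : Measure Z) [m.IsHaarMeasure]
    {f : Z → Circle} (hf : Measurable f) :
    Continuous fun s => ∫ z, ((f (z * s) * (f z)⁻¹ : Circle) : ℂ) ∂m := by
  have hL : MemLp (fun z => (f z : ℂ)) 2 m :=
    MemLp.of_bound (Circle.measurable_coe.comp hf).aestronglyMeasurable 1
      (Eventually.of_forall fun _ => (Circle.norm_coe _).le)
  let := TopologicalSpace.metrizableSpaceMetric Z
  have : Fact ((2 : ℝ≥0∞) ≠ ∞) := ⟨by norm_num⟩
  have key : Continuous fun s : Z =>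
      (inner ℂ (hL.toLp _) (DomMulAct.mk s • hL.toLp _) : ℂ) :=
    Continuous.inner continuous_const
      ((DomMulAct.mkHomeomorph.continuous).smul continuous_const)
  convert key using 2 with s
  rw [L2.inner_def]
  refine integral_congr_ae ?_
  rw [DomMulAct.mk_smul_toLp]
  filter_upwards [hL.coeFn_toLp, MemLp.coeFn_toLp (μ := m)
    (hL.comp_measurePreserving (measurePreserving_smul s m))] with z h1 h2
  refine Eq.trans ?_ (congrArg₂ (inner ℂ) h1 h2).symm
  change ((f (z * s) * (f z)⁻¹ : Circle) : ℂ) = inner ℂ (f z : ℂ) (f (s * z) : ℂ)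
  rw [Circle.coe_mul, Circle.coe_inv_eq_conj, mul_comm z s]
  rfl

/-- The two sets to be avoided have measure at most `1/4` each, so they cannot cover the group.
Hence every `s` factors into two elements outside `B`. -/
theorem exists_notMem_and_div_notMem {K : Type*} [Group K] [MeasurableSpace K] [MeasurableMul K]
    [MeasurableInv K] (μ : Measure K) [IsProbabilityMeasure μ] [μ.IsMulLeftInvariant]
    [μ.IsInvInvariant] {B : Set K} (hB : μ B ≤ 1 / 4) (s : K) : ∃ t, t ∉ B ∧ s * t⁻¹ ∉ B := by
  have hB' : μ ((fun t => s * t⁻¹) ⁻¹' B) ≤ 1 / 4 := by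
    have hmp : MeasurePreserving ((MeasurableEquiv.inv K).trans (MeasurableEquiv.mulLeft s)) μ μ :=
      (measurePreserving_mul_left μ s).comp (Measure.measurePreserving_inv μ)
    exact (hmp.measure_preimage_equiv B).trans_le hB
  by_contra! hall
  have h1 : μ (B ∪ (fun t => s * t⁻¹) ⁻¹' B) = 1 := by
    have hu : B ∪ (fun t => s * t⁻¹) ⁻¹' B = Set.univ :=
      Set.eq_univ_of_forall fun t => or_iff_not_imp_left.2 (hall t)
    rw [hu, measure_univ]
  have h2 := (measure_union_le (μ := μ) B ((fun t => s * t⁻¹) ⁻¹' B)).trans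
    (add_le_add hB hB')
  rw [h1, ← ENNReal.toReal_le_toReal (by simp) (by simp),
    ENNReal.toReal_add (by simp) (by simp)] at h2
  norm_num at h2

variable {m : Measure Z} [m.IsHaarMeasure] {K : Subgroup Z}
  {f : Z → Circle} {ε : ℝ}

/-- Closeness of almost all translates of `f` to multiples of `f` gives closeness of all of them. -/
theorem exists_derivative_close [CompactSpace K] (μ : Measure K) [μ.IsHaarMeasure]
    [IsProbabilityMeasure μ] (hf : Measurable f) {c : K → Circle}
    (hc : Measurable c) (h0 : 0 < ε)
    (h : L2Close (m.prod μ) ε (fun p => f (p.1 * p.2) * (f p.1)⁻¹) fun p => c p.2) (s : K) :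
    ∃ a : Circle, L2Close m (4 * ε) (fun z => f (z * s) * (f z)⁻¹) fun _ => a := by
  let := TopologicalSpace.metrizableSpaceMetric Z
  have hm : Measurable fun p : Z × K => f (p.1 * p.2) * (f p.1)⁻¹ := by fun_prop
  have hB := L2Close.measure_not_fibre_le hm (G := fun p : Z × K => c p.2) (by fun_prop) h0 h
  obtain ⟨t, ht⟩ := exists_notMem_and_div_notMem μ hB s
  simp only [Set.mem_ofPred_eq, not_not] at ht
  refine ⟨c t * c (s * t⁻¹), ?_⟩
  have := L2Close.derivative_mul hf (by positivity) (by positivity) ht.1 ht.2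
  rw [show 2 * ε + 2 * ε = 4 * ε by ring] at this
  simpa using this

/-- If all translates of `f` by a closed subgroup are nearly multiples of `f`, then the
multipliers are nearly given by a continuous character. -/
theorem exists_character_of_forall_derivative_close [IsProbabilityMeasure m] [CompactSpace K]
    (μ : Measure K) [μ.IsHaarMeasure] [IsProbabilityMeasure μ] (hf : Measurable f)
    (h0 : 0 < ε) (hε : 36 * ε < 1)
    (h : ∀ s : K, ∃ a : Circle, L2Close m (4 * ε) (fun z => f (z * s) * (f z)⁻¹) fun _ => a) :
    ∃ γ : K →ₜ* Circle, ∀ s : K,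
      L2Close m (84 * ε) (fun z => f (z * s) * (f z)⁻¹) fun _ => γ s := by
  let := TopologicalSpace.metrizableSpaceMetric Z
  have hm : ∀ s : Z, Measurable fun z => f (z * s) * (f z)⁻¹ := fun s => by fun_prop
  -- Each `φ s` lies within `4ε` of an admissible multiplier, so it is nonzero, and its radial
  -- projection `d` is a continuous choice of multiplier.
  set φ : K → ℂ := fun s => ∫ z, ((f (z * s) * (f z)⁻¹ : Circle) : ℂ) ∂m
  have hφc : Continuous φ := (continuous_autocorrelation m hf).comp continuous_subtype_val
  have hφa : ∀ (s : K) (a : Circle),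
      L2Close m (4 * ε) (fun z => f (z * s) * (f z)⁻¹) (fun _ => a) → ‖φ s - a‖ ≤ 4 * ε :=
    fun s a ha => ha.norm_integral_sub_le (hm s) (by positivity)
  have hφ0 : ∀ s, φ s ≠ 0 := fun s h1 => by
    obtain ⟨a, ha⟩ := h s
    have := hφa s a ha
    rw [h1, zero_sub, norm_neg, Circle.norm_coe] at this
    linarith
  set d : K → Circle := fun s => Circle.normalize (φ s)
  -- Projecting doubles `4ε` to `8ε`, and `4 + 8 = 12`.
  have hd : ∀ s : K, L2Close m (12 * ε) (fun z => f (z * s) * (f z)⁻¹) fun _ => d s := fun s => by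
    obtain ⟨a, ha⟩ := h s
    have h2 : L2Close m (8 * ε) (fun _ => a) fun _ => d s := by
      rw [L2Close.const_iff (by positivity), norm_sub_rev]
      exact (Circle.norm_normalize_sub_le _ _).trans (by linarith [hφa s a ha])
    exact (ha.trans (hm s) measurable_const measurable_const (by positivity) (by positivity)
      h2).mono (ε' := 12 * ε) (by linarith)
  -- Three uses of `hd`, at `s`, `t` and `s * t`, give `36ε`. The nearby character costs `72ε` more,
  -- and `12 + 72 = 84`.
  have hdmul : ∀ s t, ‖(d (s * t) : ℂ) - ((d s * d t : Circle) : ℂ)‖ ≤ 36 * ε := fun s t => by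
    have h1 := L2Close.derivative_mul hf (by positivity) (by positivity) (hd s) (hd t)
    have h2 := ((hd (s * t)).symm.trans measurable_const (hm _) measurable_const (by positivity)
      (by positivity) h1).mono (ε' := 36 * ε) (by linarith)
    exact (L2Close.const_iff (by positivity)).1 h2
  obtain ⟨γ, hγ⟩ := exists_character_near μ d
    (Circle.continuous_normalize_comp hφc hφ0) hε hdmul
  refine ⟨γ, fun s => ?_⟩
  have h1 : L2Close m (72 * ε) (fun _ => d s) fun _ => γ s :=
    (L2Close.const_iff (by positivity)).2 ((hγ s).trans (by linarith))
  exact ((hd s).trans (hm s) measurable_const measurable_const (by positivity) (by positivity)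
      h1).mono (ε' := 84 * ε) (by linarith)

end

/-! ### Extension of characters -/

/-- Dividing the argument by `n` gives an `n`-th root, and divisible abelian groups are injective.
-/
theorem Circle.baer_additive : Module.Baer ℤ (Additive Circle) := by
  have hex : ∀ n : ℤ, n ≠ 0 → ∀ a : Additive Circle, ∃ b : Additive Circle, n • b = a := by
    intro n hn a
    refine ⟨Additive.ofMul (Circle.exp (Complex.arg (a.toMul : ℂ) / n)), ?_⟩
    rw [← ofMul_zpow, ← Circle.exp_zsmul, zsmul_eq_mul,
      mul_div_cancel₀ _ (Int.cast_ne_zero.2 hn), Circle.exp_arg]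
    rfl
  let : DivisibleBy (Additive Circle) ℤ :=
    divisibleByOfSMulRightSurj _ _ fun hn => hex _ hn
  exact Module.Baer.of_divisible _

/-- Homomorphisms to the circle extend along injective homomorphisms of abelian groups. -/
theorem MonoidHom.exists_extension_circle {A B : Type*} [CommGroup A] [CommGroup B] (i : A →* B)
    (hi : Function.Injective i) (χ : A →* Circle) : ∃ χ' : B →* Circle, χ'.comp i = χ := by
  obtain ⟨g, hg⟩ := Circle.baer_additive.extension_property_addMonoidHom
    (MonoidHom.toAdditive i) hi (MonoidHom.toAdditive χ)
  exact ⟨MonoidHom.toAdditive.symm g, MonoidHom.ext fun x => DFunLike.congr_fun hg (.ofMul x)⟩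

/-- Characters of a factor of an internal direct product of finite index extend to the ambient
group, trivially on the other factor. -/
theorem exists_character_extension {Z : Type*} [CommGroup Z] [TopologicalSpace Z]
    [IsTopologicalGroup Z] [CompactSpace Z] [T2Space Z] {K₁ K₂ : Subgroup Z}
    (h₁ : IsClosed (K₁ : Set Z)) (h₂ : IsClosed (K₂ : Set Z)) (hinf : K₁ ⊓ K₂ = ⊥)
    (hfin : (K₁ ⊔ K₂).FiniteIndex) (γ : K₁ →ₜ* Circle) :
    ∃ γ' : Z →ₜ* Circle, (∀ k : K₁, γ' k = γ k) ∧ ∀ k ∈ K₂, γ' k = 1 := by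
  have : CompactSpace K₁ := isCompact_iff_compactSpace.1 h₁.isCompact
  have : CompactSpace K₂ := isCompact_iff_compactSpace.1 h₂.isCompact
  let i : K₁ × K₂ →* Z := K₁.subtype.coprod K₂.subtype
  have hi_apply : ∀ p, i p = p.1 * p.2 := fun p => rfl
  have hic : Continuous i := by
    change Continuous fun p : K₁ × K₂ => (p.1 : Z) * p.2
    fun_prop
  have hi : Function.Injective i := by
    refine (injective_iff_map_eq_one i).2 fun p hp => ?_
    rw [hi_apply, mul_eq_one_iff_eq_inv] at hp
    have h1 : (p.1 : Z) ∈ K₁ ⊓ K₂ := ⟨p.1.2, hp ▸ K₂.inv_mem p.2.2⟩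
    rw [hinf, Subgroup.mem_bot] at h1
    have h2 : (p.2 : Z) = 1 := by rw [h1] at hp; exact inv_eq_one.1 hp.symm
    exact Prod.ext (Subtype.ext h1) (Subtype.ext h2)
  have hemb : IsClosedEmbedding i := hic.isClosedEmbedding hi
  have hrange : i.range = K₁ ⊔ K₂ := by
    ext x
    rw [Subgroup.mem_sup, MonoidHom.mem_range]
    simp [hi_apply]
  have hclosed : IsClosed ((K₁ ⊔ K₂ : Subgroup Z) : Set Z) := by
    rw [← hrange, MonoidHom.coe_range]
    exact hemb.isClosed_range
  have hopen : IsOpen ((K₁ ⊔ K₂ : Subgroup Z) : Set Z) :=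
    Subgroup.isOpen_of_isClosed_of_finiteIndex _ hclosed
  -- This extension is purely algebraic. Continuity follows because `K₁K₂`, closed of finite index,
  -- is open, and a homomorphism need only be continuous at `1`.
  obtain ⟨χ, hχ⟩ := MonoidHom.exists_extension_circle i hi
    ((γ : K₁ →* Circle).comp (MonoidHom.fst K₁ K₂))
  have hχi : ∀ p, χ (i p) = γ p.1 := fun p => DFunLike.congr_fun hχ p
  have hχc : Continuous χ := by
    have hopemb : IsOpenEmbedding i := ⟨hemb.isEmbedding, by
      rwa [← hrange, MonoidHom.coe_range] at hopen⟩
    refine continuous_of_continuousAt_one χ ?_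
    rw [← map_one i, ← hopemb.continuousAt_iff]
    have : (χ ∘ i) = fun p => γ p.1 := funext hχi
    rw [this]
    fun_prop
  refine ⟨⟨χ, hχc⟩, fun k => ?_, fun k hk => ?_⟩
  · change χ k = γ k
    simpa [hi_apply] using hχi (k, 1)
  · change χ k = 1
    simpa [hi_apply] using hχi (1, ⟨k, hk⟩)

/-! ### Nearly invariant functions and quotients -/

section

variable {Z : Type*} [CommGroup Z] [TopologicalSpace Z] [IsTopologicalGroup Z] [CompactSpace Z]
  [TopologicalSpace.MetrizableSpace Z] [MeasurableSpace Z] [BorelSpace Z]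
  {m : Measure Z} {K : Subgroup Z}

/-- A function which is nearly invariant under a subgroup is near a function on the quotient. -/
theorem exists_quotient_close [SFinite m] (μ : Measure K) [IsProbabilityMeasure μ]
    [μ.IsMulLeftInvariant] {φ : Z → Circle} (hφ : Measurable φ) {κ : ℝ} (h0 : 0 ≤ κ)
    (h : ∀ s : K, L2Close m κ (fun z => φ (z * s)) φ) :
    ∃ g : Z ⧸ K → Circle, Measurable g ∧ L2Close m (2 * κ) φ fun z => g (z : Z ⧸ K) := by
  let := TopologicalSpace.metrizableSpaceMetric Z
  have hm2 : Measurable fun p : Z × K => φ (p.1 * p.2) := by fun_prop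
  -- Averaging over cosets of `K` gives an exactly invariant function. Its radial projection
  -- descends to the quotient and costs the factor `2`.
  set G : Z → ℂ := fun z => ∫ s : K, (φ (z * s) : ℂ) ∂μ with hG
  have hGm : Measurable G :=
    ((Circle.measurable_coe.comp hm2).stronglyMeasurable.integral_prod_right
      (f := fun (z : Z) (s : K) => (φ (z * s) : ℂ)) (ν := μ)).measurable
  have hGinv : ∀ (z : Z) (k : K), G (z * k) = G z := fun z k => by
    have h1 := integral_mul_left_eq_self (μ := μ) (fun s : K => (φ (z * s) : ℂ)) k
    refine Eq.trans ?_ h1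
    simp only [hG, mul_assoc, Subgroup.coe_mul]
  let g : Z ⧸ K → Circle := Quotient.lift (fun z => Circle.normalize (G z)) fun a b hab => by
    have h1 : a⁻¹ * b ∈ K := QuotientGroup.leftRel_apply.1 hab
    have h2 := hGinv a ⟨_, h1⟩
    rw [mul_inv_cancel_left] at h2
    simp only [h2]
  refine ⟨g, measurable_from_quotient.2 (Circle.measurable_normalize.comp hGm), ?_⟩
  rw [L2Close.iff_lintegral (by positivity)]
  have hpt : ∀ z, ‖(φ z : ℂ) - g (z : Z ⧸ K)‖ₑ ^ 2
      ≤ ENNReal.ofReal 4 * ∫⁻ s : K, ‖(φ (z * s) : ℂ) - φ z‖ₑ ^ 2 ∂μ := fun z => by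
    have h1 := Circle.enorm_integral_sub_sq_le (μ := μ) (F := fun s : K => φ (z * s))
      (by fun_prop) (φ z)
    refine le_trans ?_ (mul_le_mul_right h1 _)
    change ‖(φ z : ℂ) - Circle.normalize (G z)‖ₑ ^ 2 ≤ _ * ‖G z - φ z‖ₑ ^ 2
    have h2 := Circle.norm_normalize_sub_le (G z) (φ z)
    rw [← ofReal_norm, ← ofReal_norm, ← ENNReal.ofReal_pow (norm_nonneg _),
      ← ENNReal.ofReal_pow (norm_nonneg _), ← ENNReal.ofReal_mul (by norm_num), norm_sub_rev]
    refine ENNReal.ofReal_le_ofReal ?_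
    calc _ ≤ (2 * ‖G z - φ z‖) ^ 2 := pow_le_pow_left₀ (norm_nonneg _) h2 2
      _ = _ := by ring
  have hprod := L2Close.measurable_enorm_sub_sq hm2 (hφ.comp measurable_fst)
  calc _ ≤ ∫⁻ z, ENNReal.ofReal 4 * ∫⁻ s : K, ‖(φ (z * s) : ℂ) - φ z‖ₑ ^ 2 ∂μ ∂m :=
        lintegral_mono hpt
    _ = ENNReal.ofReal 4 * ∫⁻ s : K, ∫⁻ z, ‖(φ (z * s) : ℂ) - φ z‖ₑ ^ 2 ∂m ∂μ := by
        rw [lintegral_const_mul' _ _ ENNReal.ofReal_ne_top,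
          lintegral_lintegral_swap hprod.aemeasurable]
    _ ≤ ENNReal.ofReal 4 * ∫⁻ _ : K, ENNReal.ofReal (κ ^ 2) ∂μ := by
        gcongr with s
        exact (L2Close.iff_lintegral h0).1 (h s)
    _ = ENNReal.ofReal ((2 * κ) ^ 2) := by
        rw [lintegral_const, measure_univ, mul_one, ← ENNReal.ofReal_mul (by norm_num)]
        congr 1; ring

theorem exists_quotient_mul_character_close [SFinite m] (μ : Measure K) [IsProbabilityMeasure μ]
    [μ.IsMulLeftInvariant] {f : Z → Circle} (hf : Measurable f) (γ : Z →ₜ* Circle) {κ : ℝ}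
    (h0 : 0 ≤ κ) (h : ∀ s : K, L2Close m κ (fun z => f (z * s) * (f z)⁻¹) fun _ => γ s) :
    ∃ g : Z ⧸ K → Circle, Measurable g ∧
      L2Close m (2 * κ) f fun z => g (z : Z ⧸ K) * γ z := by
  let := TopologicalSpace.metrizableSpaceMetric Z
  have hγ : Measurable γ := (map_continuous γ).measurable
  obtain ⟨g, hg, hgc⟩ := exists_quotient_close (m := m) μ (φ := fun z => f z * (γ z)⁻¹)
    (by fun_prop) h0 fun s => by
      refine ((h s).mul_left fun z => f z * (γ z)⁻¹ * (γ s)⁻¹).of_norm_eq fun z => ?_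
      have e1 : f (z * s) * (γ (z * s))⁻¹
          = f z * (γ z)⁻¹ * (γ s)⁻¹ * (f (z * s) * (f z)⁻¹) := by
        rw [map_mul]
        exact Circle.ext (by push_cast; field_simp)
      rw [e1, inv_mul_cancel_right]
  refine ⟨g, hg, (hgc.mul_left γ).of_norm_eq fun z => ?_⟩
  rw [mul_comm (γ z), mul_comm (γ z), inv_mul_cancel_right]

end

/-! ### Extracting a character from the corner equation -/

section

variable {Z : Type*} [CommGroup Z] [TopologicalSpace Z] [IsTopologicalGroup Z] [CompactSpace Z]
  [TopologicalSpace.MetrizableSpace Z] [MeasurableSpace Z] [BorelSpace Z]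
  {K₁ K₂ : Subgroup Z} {m : Measure Z} {m₁ : Measure K₁} {m₂ : Measure K₂}
  [m.IsHaarMeasure] [IsProbabilityMeasure m₁] [IsProbabilityMeasure m₂]
  {δ : ℝ} {f₁ f₂ f₃ : Z → Circle} {h : K₁ × K₂ → Circle}

/-- The substitution `z ↦ z(uv)⁻¹` preserves measure on each fibre over `(u, v)`. Afterwards `f₂`
sees only `z`, `f₁` is free of `u`, and `f₃` is free of `v`. -/
theorem L2Close.corner_shear (hf₁ : Measurable f₁) (hf₂ : Measurable f₂) (hf₃ : Measurable f₃)
    (hh : Measurable h)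
    (H : L2Close (m.prod (m₁.prod m₂)) δ
      (fun p : Z × K₁ × K₂ =>
        f₁ (p.1 * p.2.1) * f₂ (p.1 * p.2.1 * p.2.2) * f₃ (p.1 * p.2.2) * h (p.2.1, p.2.2))
      (fun _ => 1)) :
    L2Close (m.prod (m₁.prod m₂)) δ
      (fun p : Z × K₁ × K₂ =>
        f₁ (p.1 * (p.2.2 : Z)⁻¹) * f₂ p.1 * f₃ (p.1 * (p.2.1 : Z)⁻¹) * h p.2)
      (fun _ => 1) := by
  let := TopologicalSpace.metrizableSpaceMetric Z
  have hT : MeasurePreserving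
      (fun p : (K₁ × K₂) × Z => (p.1, p.2 * ((p.1.1 : Z) * p.1.2)⁻¹))
      ((m₁.prod m₂).prod m) ((m₁.prod m₂).prod m) := by
    refine MeasurePreserving.skew_product (MeasurePreserving.id _)
      (g := fun (x : K₁ × K₂) (z : Z) => z * ((x.1 : Z) * x.2)⁻¹) ?_ ?_
    · simp only [Function.uncurry_def]; fun_prop
    · exact Eventually.of_forall fun x => map_mul_right_eq_self m _
  have hT' := (Measure.measurePreserving_swap.comp hT).comp
    (Measure.measurePreserving_swap (μ := m) (ν := m₁.prod m₂))
  refine (H.comp (by fun_prop) (by fun_prop) hT').congr (fun ⟨z, u, v⟩ => ?_) fun _ => rfl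
  have e1 : z * ((u : Z) * v)⁻¹ * u = z * (v : Z)⁻¹ := by
    rw [mul_inv, mul_comm (u : Z)⁻¹, mul_assoc, inv_mul_cancel_right]
  have e2 : z * ((u : Z) * v)⁻¹ * v = z * (u : Z)⁻¹ := by
    rw [mul_inv, mul_assoc, inv_mul_cancel_right]
  simp only [Function.comp, Prod.swap_prod_mk, e1, e2, inv_mul_cancel_right]

/-- The factor `f₁(zv⁻¹) f₂(z)` is common to the equations at two values of `u` and cancels. -/
theorem L2Close.corner_compare (hf₁ : Measurable f₁) (hf₂ : Measurable f₂) (hf₃ : Measurable f₃)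
    (hh : Measurable h) (h0 : 0 ≤ δ)
    (H : L2Close (m.prod (m₁.prod m₂)) δ
      (fun p : Z × K₁ × K₂ =>
        f₁ (p.1 * (p.2.2 : Z)⁻¹) * f₂ p.1 * f₃ (p.1 * (p.2.1 : Z)⁻¹) * h p.2)
      (fun _ => 1)) :
    L2Close (m.prod (m₁.prod (m₁.prod m₂))) (2 * δ)
      (fun p : Z × K₁ × K₁ × K₂ => f₃ (p.1 * (p.2.1 : Z)⁻¹) * h (p.2.1, p.2.2.2))
      (fun p => f₃ (p.1 * (p.2.2.1 : Z)⁻¹) * h p.2.2) := by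
  let := TopologicalSpace.metrizableSpaceMetric Z
  have hπ₁ : MeasurePreserving (Prod.map id (Prod.map id Prod.snd) :
      Z × K₁ × K₁ × K₂ → Z × K₁ × K₂) (m.prod (m₁.prod (m₁.prod m₂)))
      (m.prod (m₁.prod m₂)) :=
    (MeasurePreserving.id m).prod ((MeasurePreserving.id m₁).prod measurePreserving_snd)
  have hπ₂ : MeasurePreserving (Prod.map id Prod.snd :
      Z × K₁ × K₁ × K₂ → Z × K₁ × K₂) (m.prod (m₁.prod (m₁.prod m₂)))
      (m.prod (m₁.prod m₂)) :=
    (MeasurePreserving.id m).prod measurePreserving_snd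
  have e1 := H.comp (by fun_prop) (by fun_prop) hπ₁
  have e2 := H.comp (by fun_prop) (by fun_prop) hπ₂
  have e3 := e1.trans (by fun_prop) (by fun_prop) (by fun_prop) h0 h0 e2.symm
  rw [← two_mul] at e3
  refine (e3.mul_left fun p => (f₁ (p.1 * (p.2.2.2 : Z)⁻¹) * f₂ p.1)⁻¹).congr
    (fun p => ?_) fun p => ?_
  all_goals
    simp only [Prod.map_fst, Prod.map_snd, id]
    rw [mul_assoc (f₁ _ * f₂ _), inv_mul_cancel_left]
  rfl

theorem exists_character_of_corner [IsProbabilityMeasure m] [m₁.IsHaarMeasure]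
    (h₁ : IsClosed (K₁ : Set Z)) (h₂ : IsClosed (K₂ : Set Z)) (hinf : K₁ ⊓ K₂ = ⊥)
    (hfin : (K₁ ⊔ K₂).FiniteIndex) (hf₃ : Measurable f₃)
    (hh : Measurable h) (h0 : 0 < δ) (h0' : δ < 1 / 100)
    (H : L2Close (m.prod (m₁.prod (m₁.prod m₂))) (2 * δ)
      (fun p : Z × K₁ × K₁ × K₂ => f₃ (p.1 * (p.2.1 : Z)⁻¹) * h (p.2.1, p.2.2.2))
      (fun p => f₃ (p.1 * (p.2.2.1 : Z)⁻¹) * h p.2.2)) :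
    ∃ (g : Z ⧸ K₁ → Circle) (γ : Z →ₜ* Circle) (b : K₂ → Circle), Measurable g ∧ Measurable b ∧
      (∀ k ∈ K₂, γ k = 1) ∧ L2Close m (336 * δ) f₃ (fun z => g (z : Z ⧸ K₁) * γ z) ∧
      L2Close (m₁.prod m₂) (338 * δ) h fun p => γ p.1 * b p.2 := by
  let := TopologicalSpace.metrizableSpaceMetric Z
  have : CompactSpace K₁ := isCompact_iff_compactSpace.1 h₁.isCompact
  obtain ⟨⟨u₀, v₀⟩, hx⟩ := L2Close.exists_fibre (μ := m.prod m₁) (ν := m₁.prod m₂)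
    (by fun_prop) (by fun_prop) (by positivity)
    (H.comp (by fun_prop) (by fun_prop) (measurePreserving_prodAssoc m m₁ (m₁.prod m₂)))
  -- With `(u₀, v₀)` fixed, replacing `z` by `z u₀` and the other `K₁` variable by `s⁻¹ u₀` turns
  -- the comparison into one of `f₃(zs)` with `f₃(z)`.
  have hS : MeasurePreserving (Prod.map (fun z : Z => z * u₀) fun s : K₁ => s⁻¹ * u₀)
      (m.prod m₁) (m.prod m₁) :=
    (measurePreserving_mul_right m (u₀ : Z)).prod
      ((measurePreserving_mul_right m₁ u₀).comp (Measure.measurePreserving_inv m₁))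
  have hx' : L2Close (m.prod m₁) (2 * δ) (fun p => f₃ (p.1 * p.2) * (f₃ p.1)⁻¹)
      fun p => h (u₀, v₀) * (h (p.2⁻¹ * u₀, v₀))⁻¹ := by
    have := (hx.comp (by fun_prop) (by fun_prop) hS).mul_left
      fun p => (f₃ p.1)⁻¹ * (h (p.2⁻¹ * u₀, v₀))⁻¹
    refine this.congr (fun p => ?_) fun p => ?_
    · have e : p.1 * (u₀ : Z) * ((p.2⁻¹ * u₀ : K₁) : Z)⁻¹ = p.1 * p.2 := by
        rw [Subgroup.coe_mul, Subgroup.coe_inv, mul_inv, inv_inv, mul_assoc, mul_comm (p.2 : Z),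
          mul_inv_cancel_left]
      simp only [MeasurableEquiv.prodAssoc, Prod.map_fst, Prod.map_snd, MeasurableEquiv.coe_mk,
        Equiv.prodAssoc_apply, e]
      exact Circle.ext (by push_cast; field_simp)
    · simp only [MeasurableEquiv.prodAssoc, Prod.map_fst, Prod.map_snd, MeasurableEquiv.coe_mk,
        Equiv.prodAssoc_apply, mul_inv_cancel_right]
      exact Circle.ext (by push_cast; field_simp)
  -- With `ε = 2δ` the requirement is `72δ < 1`, and `84ε = 168δ`.
  obtain ⟨γ₀, hγ₀⟩ := exists_character_of_forall_derivative_close m₁ hf₃ (ε := 2 * δ)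
    (by positivity) (by linarith)
    (exists_derivative_close m₁ hf₃ (c := fun s => h (u₀, v₀) * (h (s⁻¹ * u₀, v₀))⁻¹)
      (by fun_prop) (by positivity) hx')
  obtain ⟨γ, hγ, hγ₂⟩ := exists_character_extension h₁ h₂ hinf hfin γ₀
  have hγm : Measurable γ := (map_continuous γ).measurable
  simp only [← hγ] at hγ₀
  obtain ⟨g, hg, hgc⟩ := exists_quotient_mul_character_close m₁ hf₃ γ (by positivity) hγ₀
  have hder : ∀ w : K₁, L2Close m (168 * δ)
      (fun z => f₃ (z * (w : Z)⁻¹) * (f₃ z)⁻¹) fun _ => (γ w)⁻¹ := fun w => by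
    have := hγ₀ w⁻¹
    rw [Subgroup.coe_inv, map_inv] at this
    exact this.mono (by linarith)
  have hw : L2Close (m.prod (m₁.prod (m₁.prod m₂))) (168 * δ)
      (fun p => f₃ (p.1 * (p.2.1 : Z)⁻¹) * (f₃ p.1)⁻¹) fun p => (γ p.2.1)⁻¹ :=
    L2Close.prod_of_forall (by fun_prop) (by fun_prop) (by positivity) fun y => hder y.1
  have hu : L2Close (m.prod (m₁.prod (m₁.prod m₂))) (168 * δ)
      (fun p => f₃ (p.1 * (p.2.2.1 : Z)⁻¹) * (f₃ p.1)⁻¹) fun p => (γ p.2.2.1)⁻¹ :=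
    L2Close.prod_of_forall (by fun_prop) (by fun_prop) (by positivity) fun y => hder y.2.1
  have c1 := hw.symm.mul_left fun p => h (p.2.1, p.2.2.2)
  have c2 := hu.mul_left fun p => h p.2.2
  have c3 : L2Close (m.prod (m₁.prod (m₁.prod m₂))) (2 * δ)
      (fun p => h (p.2.1, p.2.2.2) * (f₃ (p.1 * (p.2.1 : Z)⁻¹) * (f₃ p.1)⁻¹))
      fun p => h p.2.2 * (f₃ (p.1 * (p.2.2.1 : Z)⁻¹) * (f₃ p.1)⁻¹) := by
    refine (H.mul_left fun p => (f₃ p.1)⁻¹).congr (fun p => ?_) fun p => ?_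
    all_goals exact Circle.ext (by push_cast; ring)
  -- This compares `h(w,v) γ(w)⁻¹` with `h(u,v) γ(u)⁻¹`, at cost `168 + 2 + 168 = 338`. Freezing `z`
  -- and then `w` separates the variables.
  have c4 := (c1.trans (by fun_prop) (by fun_prop) (by fun_prop) (by positivity) (by positivity)
    c3).trans (by fun_prop) (by fun_prop) (by fun_prop) (by positivity) (by positivity) c2
  obtain ⟨_, c5⟩ := L2Close.exists_fibre_left (by fun_prop) (by fun_prop) (by positivity) c4
  obtain ⟨w, c6⟩ := L2Close.exists_fibre_left (by fun_prop) (by fun_prop) (by positivity) c5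
  refine ⟨g, γ, fun v => h (w, v) * (γ w)⁻¹, hg, by fun_prop, hγ₂, hgc.mono (by linarith), ?_⟩
  refine ((c6.mul_left fun p => γ p.1).symm.mono (by linarith)).congr (fun p => ?_) fun p => ?_
  · exact Circle.ext (by push_cast; field_simp)
  · rfl

end

/-! ### Symmetry, the middle function and the conclusion -/

section

variable {Z : Type*} [CommGroup Z] [TopologicalSpace Z] [IsTopologicalGroup Z] [CompactSpace Z]
  [TopologicalSpace.MetrizableSpace Z] [MeasurableSpace Z] [BorelSpace Z]
  {K₁ K₂ : Subgroup Z} {m : Measure Z} {m₁ : Measure K₁} {m₂ : Measure K₂}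
  [m.IsHaarMeasure] [IsProbabilityMeasure m₁] [IsProbabilityMeasure m₂]
  {δ : ℝ} {f₁ f₂ f₃ : Z → Circle} {h : K₁ × K₂ → Circle}

theorem L2Close.corner_swap (hf₁ : Measurable f₁) (hf₂ : Measurable f₂) (hf₃ : Measurable f₃)
    (hh : Measurable h)
    (H : L2Close (m.prod (m₁.prod m₂)) δ
      (fun p : Z × K₁ × K₂ =>
        f₁ (p.1 * (p.2.2 : Z)⁻¹) * f₂ p.1 * f₃ (p.1 * (p.2.1 : Z)⁻¹) * h p.2)
      (fun _ => 1)) :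
    L2Close (m.prod (m₂.prod m₁)) δ
      (fun p : Z × K₂ × K₁ =>
        f₃ (p.1 * (p.2.2 : Z)⁻¹) * f₂ p.1 * f₁ (p.1 * (p.2.1 : Z)⁻¹) * h p.2.swap)
      (fun _ => 1) := by
  let := TopologicalSpace.metrizableSpaceMetric Z
  refine (H.comp (by fun_prop) (by fun_prop) ((MeasurePreserving.id m).prod
    (Measure.measurePreserving_swap (μ := m₂) (ν := m₁)))).congr (fun p => ?_) fun _ => rfl
  simp only [Prod.map_fst, Prod.map_snd, id, Prod.fst_swap, Prod.snd_swap]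
  rw [mul_right_comm (f₃ _), mul_comm (f₃ _), mul_right_comm (f₁ _)]

/-- A function which is nearly `a u * b v` in two ways, each with one factor known, is nearly a
multiple of the product of the known factors. -/
theorem L2Close.exists_const_mul {X Y : Type*} [MeasurableSpace X] [MeasurableSpace Y]
    {μ : Measure X} {ν : Measure Y} [IsProbabilityMeasure μ] [IsProbabilityMeasure ν]
    {h : X × Y → Circle} {p a : X → Circle} {q b : Y → Circle} (hh : Measurable h)
    (hp : Measurable p) (ha : Measurable a) (hq : Measurable q) (hb : Measurable b) {ε : ℝ}
    (h0 : 0 ≤ ε) (h₁ : L2Close (μ.prod ν) ε h fun x => p x.1 * b x.2)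
    (h₂ : L2Close (μ.prod ν) ε h fun x => a x.1 * q x.2) :
    ∃ β : Circle, L2Close (μ.prod ν) (3 * ε) h fun x => β * p x.1 * q x.2 := by
  have c1 := (h₁.symm.trans (by fun_prop) (by fun_prop) (by fun_prop) h0 h0 h₂).mul_left
    fun x => (p x.1)⁻¹ * (q x.2)⁻¹
  -- On one good fibre `p x * b y ≈ a x * q y`, so `b` is within `2ε` of a constant multiple of `q`.
  obtain ⟨x, c2⟩ := L2Close.exists_fibre_left (by fun_prop) (by fun_prop) (by positivity) c1
  refine ⟨a x * (p x)⁻¹, ?_⟩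
  have c3 : L2Close ν (ε + ε) b fun y => a x * (p x)⁻¹ * q y :=
    (c2.mul_left q).congr (fun y => Circle.ext (by push_cast; field_simp))
      fun y => Circle.ext (by push_cast; field_simp)
  have c4 := (c3.comp hb (by fun_prop) (measurePreserving_snd (μ := μ))).mul_left
    fun z => p z.1
  refine ((h₁.trans hh (by fun_prop) (by fun_prop) h0 (by positivity) c4).mono
    (by linarith)).congr (fun _ => rfl) fun z => ?_
  exact Circle.ext (by push_cast; ring)

/-- The phases `γ₂(v)⁻¹` and `γ₁(u)⁻¹` produced by the shifts cancel those in the approximation to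
`h`. The resulting approximation to `f₂` depends on `z` alone, so any good fibre gives it. -/
theorem L2Close.corner_middle [IsProbabilityMeasure m] (hf₁ : Measurable f₁) (hf₂ : Measurable f₂)
    (hf₃ : Measurable f₃) (hh : Measurable h) (h0 : 0 ≤ δ)
    (H : L2Close (m.prod (m₁.prod m₂)) δ
      (fun p : Z × K₁ × K₂ =>
        f₁ (p.1 * (p.2.2 : Z)⁻¹) * f₂ p.1 * f₃ (p.1 * (p.2.1 : Z)⁻¹) * h p.2)
      (fun _ => 1))
    {q₁ q₂ : Z → Circle} {γ₁ γ₂ : Z →ₜ* Circle} {β : Circle}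
    (hq₁ : Measurable q₁) (hq₂ : Measurable q₂) (hi₁ : ∀ z, ∀ k ∈ K₂, q₁ (z * k) = q₁ z)
    (hi₂ : ∀ z, ∀ k ∈ K₁, q₂ (z * k) = q₂ z) {ε₁ ε₃ ε : ℝ}
    (h0₁ : 0 ≤ ε₁) (h0₃ : 0 ≤ ε₃) (h0' : 0 ≤ ε)
    (H₁ : L2Close m ε₁ f₁ fun z => q₁ z * γ₂ z)
    (H₃ : L2Close m ε₃ f₃ fun z => q₂ z * γ₁ z)
    (Hh : L2Close (m₁.prod m₂) ε h fun p => β * γ₁ p.1 * γ₂ p.2) :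
    L2Close m (δ + (ε₁ + ε₃ + ε)) f₂
      fun z => β⁻¹ * (q₁ z * γ₁ z * q₂ z * γ₂ z)⁻¹ := by
  let := TopologicalSpace.metrizableSpaceMetric Z
  have hγ₁ : Measurable γ₁ := (map_continuous γ₁).measurable
  have hγ₂ : Measurable γ₂ := (map_continuous γ₂).measurable
  have hs₁ : ∀ v : K₂, L2Close m ε₁ (fun z => f₁ (z * (v : Z)⁻¹))
      fun z => q₁ z * (γ₂ z * (γ₂ v)⁻¹) := fun v => by
    have := H₁.comp hf₁ (by fun_prop) (measurePreserving_mul_right m (v : Z)⁻¹)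
    simpa only [hi₁ _ _ (K₂.inv_mem v.2), map_mul, map_inv] using this
  have hs₃ : ∀ u : K₁, L2Close m ε₃ (fun z => f₃ (z * (u : Z)⁻¹))
      fun z => q₂ z * (γ₁ z * (γ₁ u)⁻¹) := fun u => by
    have := H₃.comp hf₃ (by fun_prop) (measurePreserving_mul_right m (u : Z)⁻¹)
    simpa only [hi₂ _ _ (K₁.inv_mem u.2), map_mul, map_inv] using this
  have c₁ : L2Close (m.prod (m₁.prod m₂)) ε₁ (fun p : Z × K₁ × K₂ => f₁ (p.1 * (p.2.2 : Z)⁻¹))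
      fun p => q₁ p.1 * (γ₂ p.1 * (γ₂ p.2.2)⁻¹) :=
    L2Close.prod_of_forall (by fun_prop) (by fun_prop) h0₁ fun y => hs₁ y.2
  have c₃ : L2Close (m.prod (m₁.prod m₂)) ε₃ (fun p : Z × K₁ × K₂ => f₃ (p.1 * (p.2.1 : Z)⁻¹))
      fun p => q₂ p.1 * (γ₁ p.1 * (γ₁ p.2.1)⁻¹) :=
    L2Close.prod_of_forall (by fun_prop) (by fun_prop) h0₃ fun y => hs₃ y.1
  have hr : Measurable fun p : K₁ × K₂ => β * γ₁ p.1 * γ₂ p.2 := by fun_prop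
  have ch : L2Close (m.prod (m₁.prod m₂)) ε (fun p => h p.2)
      fun p => β * γ₁ p.2.1 * γ₂ p.2.2 :=
    Hh.comp hh hr (measurePreserving_snd (μ := m) (ν := m₁.prod m₂))
  have c := ((c₁.mul (by fun_prop) (by fun_prop) (by fun_prop) (by fun_prop) h0₁ h0₃ c₃).mul
    (by fun_prop) (by fun_prop) (by fun_prop) (by fun_prop) (by positivity) h0' ch).inv
  have c' : L2Close (m.prod (m₁.prod m₂)) δ (fun p => f₂ p.1)
      fun p => (f₁ (p.1 * (p.2.2 : Z)⁻¹) * f₃ (p.1 * (p.2.1 : Z)⁻¹) * h p.2)⁻¹ :=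
    (H.mul_left fun p => (f₁ (p.1 * (p.2.2 : Z)⁻¹) * f₃ (p.1 * (p.2.1 : Z)⁻¹) * h p.2)⁻¹).congr
      (fun p => Circle.ext (by push_cast; field_simp)) fun p => (mul_one _).symm
  have c'' : L2Close (m.prod (m₁.prod m₂)) (δ + (ε₁ + ε₃ + ε)) (fun p => f₂ p.1)
      fun p => β⁻¹ * (q₁ p.1 * γ₁ p.1 * q₂ p.1 * γ₂ p.1)⁻¹ :=
    (c'.trans (by fun_prop) (by fun_prop) (by fun_prop) h0 (by positivity) c).congr
      (fun _ => rfl) fun p => Circle.ext (by push_cast; field_simp)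
  obtain ⟨_, r⟩ := L2Close.exists_fibre (hf₂.comp measurable_fst)
    (G := fun p => β⁻¹ * (q₁ p.1 * γ₁ p.1 * q₂ p.1 * γ₂ p.1)⁻¹)
    (by fun_prop) (by positivity) c''
  exact r

end

theorem lemma3p33 :
    ∃ ω : ℝ → ℝ, Tendsto ω (𝓝[>] 0) (𝓝 0) ∧
      ∀ (Z : Type u) [CommGroup Z] [TopologicalSpace Z] [IsTopologicalGroup Z] [CompactSpace Z]
        [TopologicalSpace.MetrizableSpace Z] [MeasurableSpace Z] [BorelSpace Z]
        (K₁ K₂ : Subgroup Z), IsClosed (K₁ : Set Z) → IsClosed (K₂ : Set Z) →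
        K₁ ⊓ K₂ = ⊥ → (K₁ ⊔ K₂).FiniteIndex →
      ∀ (m : Measure Z) (m₁ : Measure K₁) (m₂ : Measure K₂)
        [m.IsHaarMeasure] [IsProbabilityMeasure m]
        [m₁.IsHaarMeasure] [IsProbabilityMeasure m₁]
        [m₂.IsHaarMeasure] [IsProbabilityMeasure m₂]
        (δ : ℝ), 0 < δ → δ < 1 / 100 →
      ∀ (f₁ f₂ f₃ : Z → Circle) (h : K₁ × K₂ → Circle),
        Measurable f₁ → Measurable f₂ → Measurable f₃ → Measurable h →
        L2Close (m.prod (m₁.prod m₂)) δ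
          (fun p : Z × K₁ × K₂ =>
            f₁ (p.1 * p.2.1) * f₂ (p.1 * p.2.1 * p.2.2) * f₃ (p.1 * p.2.2) * h (p.2.1, p.2.2))
          (fun _ => 1) →
        ∃ (g₁ : Z ⧸ K₂ → Circle) (g₂ : Z ⧸ K₁ → Circle) (γ₁ γ₂ : Z →ₜ* Circle)
          (α₁ α₂ α₃ β : Circle),
          Measurable g₁ ∧ Measurable g₂ ∧
          (∀ k ∈ K₂, γ₁ k = 1) ∧ (∀ k ∈ K₁, γ₂ k = 1) ∧
          α₁ * α₂ * α₃ * β = 1 ∧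
          L2Close m (ω δ) f₁ (fun z => α₁ * (g₁ (z : Z ⧸ K₂) * γ₂ z)) ∧
          L2Close m (ω δ) f₂
            (fun z => α₂ * (g₁ (z : Z ⧸ K₂) * γ₁ z * g₂ (z : Z ⧸ K₁) * γ₂ z)⁻¹) ∧
          L2Close m (ω δ) f₃ (fun z => α₃ * (g₂ (z : Z ⧸ K₁) * γ₁ z)) ∧
          L2Close (m₁.prod m₂) (ω δ) h (fun p => β * γ₁ (p.1 : Z) * γ₂ (p.2 : Z)) ∧
          (∀ z : Z,
            α₁ * (g₁ (z : Z ⧸ K₂) * γ₂ z) *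
              (α₂ * (g₁ (z : Z ⧸ K₂) * γ₁ z * g₂ (z : Z ⧸ K₁) * γ₂ z)⁻¹) *
              (α₃ * (g₂ (z : Z ⧸ K₁) * γ₁ z)) = β⁻¹) ∧
          L2Close m (ω δ) (fun z => f₁ z * f₂ z * f₃ z) (fun _ => β⁻¹) := by
  -- The errors are `336δ` for `f₁` and `f₃`, `3 · 338δ = 1014δ` for `h`, `(1 + 336 + 336 + 1014)δ =
  -- 1687δ` for `f₂`, and `2359δ` for the product. Any larger constant serves.
  refine ⟨fun δ => 3000 * δ, ?_, ?_⟩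
  · refine tendsto_nhdsWithin_of_tendsto_nhds ?_
    exact Continuous.tendsto' (by fun_prop) _ _ (by simp)
  intro Z _ _ _ _ _ _ _ K₁ K₂ h₁ h₂ hinf hfin m m₁ m₂ _ _ _ _ _ _ δ h0 h0' f₁ f₂ f₃ h hf₁ hf₂ hf₃
    hh H
  let := TopologicalSpace.metrizableSpaceMetric Z
  have N := L2Close.corner_shear hf₁ hf₂ hf₃ hh H
  have N' := L2Close.corner_swap hf₁ hf₂ hf₃ hh N
  obtain ⟨g₂, γ₁, b, hg₂, hb, hγ₁, H₃, Hb⟩ := exists_character_of_corner h₁ h₂ hinf hfin hf₃ hh h0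
    h0' (L2Close.corner_compare hf₁ hf₂ hf₃ hh h0.le N)
  obtain ⟨g₁, γ₂, a, hg₁, ha, hγ₂, H₁, Ha⟩ := exists_character_of_corner h₂ h₁
    (inf_comm K₁ K₂ ▸ hinf) (sup_comm K₁ K₂ ▸ hfin) hf₁ (hh.comp measurable_swap) h0
    h0' (L2Close.corner_compare hf₃ hf₂ hf₁ (hh.comp measurable_swap) h0.le N')
  have hγ₁m : Measurable γ₁ := (map_continuous γ₁).measurable
  have hγ₂m : Measurable γ₂ := (map_continuous γ₂).measurable
  have Ha' : L2Close (m₁.prod m₂) (338 * δ) h fun p => a p.1 * γ₂ p.2 :=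
    (Ha.comp (hh.comp measurable_swap) (by fun_prop)
      (Measure.measurePreserving_swap (μ := m₁) (ν := m₂))).congr (fun _ => rfl)
      fun _ => mul_comm _ _
  obtain ⟨β, Hh⟩ := L2Close.exists_const_mul (p := fun u : K₁ => γ₁ u) (q := fun v : K₂ => γ₂ v)
    hh (by fun_prop) ha (by fun_prop) hb (by positivity) Hb Ha'
  have hq₁ : Measurable fun z : Z => g₁ (z : Z ⧸ K₂) := measurable_from_quotient.1 hg₁
  have hq₂ : Measurable fun z : Z => g₂ (z : Z ⧸ K₁) := measurable_from_quotient.1 hg₂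
  have H₂ := L2Close.corner_middle hf₁ hf₂ hf₃ hh h0.le N hq₁ hq₂
    (fun z k hk => by simp only [QuotientGroup.mk_mul_of_mem z hk])
    (fun z k hk => by simp only [QuotientGroup.mk_mul_of_mem z hk]) (by positivity) (by positivity)
    (by positivity) H₁ H₃ Hh
  have hprod : ∀ z : Z, g₁ (z : Z ⧸ K₂) * γ₂ z *
      (β⁻¹ * (g₁ (z : Z ⧸ K₂) * γ₁ z * g₂ (z : Z ⧸ K₁) * γ₂ z)⁻¹) *
      (g₂ (z : Z ⧸ K₁) * γ₁ z) = β⁻¹ := fun z => Circle.ext (by push_cast; field_simp)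
  -- The constants of `f₁` and `f₃` are absorbed into `g₁` and `g₂`, so only `f₂` carries `β⁻¹`.
  refine ⟨g₁, g₂, γ₁, γ₂, 1, β⁻¹, 1, β, hg₁, hg₂, hγ₁, hγ₂, by simp, ?_, ?_, ?_, ?_, ?_, ?_⟩
  · simpa only [one_mul] using H₁.mono (by linarith)
  · exact H₂.mono (by linarith)
  · simpa only [one_mul] using H₃.mono (by linarith)
  · exact Hh.mono (by linarith)
  · simpa only [one_mul] using hprod
  · refine (((H₁.mul (by fun_prop) (by fun_prop) (by fun_prop) (by fun_prop) (by positivity)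
      (by positivity) H₂).mul (by fun_prop) (by fun_prop) (by fun_prop) (by fun_prop)
      (by positivity) (by positivity) H₃).mono (by linarith)).congr (fun _ => rfl)
      fun z => (hprod z).symm
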